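/- A binary word is a finite sequence $w = w_1 w_2 \cdots w_n$ with all $w_i \in \{0,1\}$, and $n$ is its length. An occurrence of a binary word $p = p_1 \cdots p_l$ in $w$ is a choice of indices $1 \le i_1 < i_2 < \cdots < i_l \le n$ such that $w_{i_1} w_{i_2} \cdots w_{i_l} = p$. Let $B_{n,p}(k)$ be the number of binary words of length $n$ that have exactly $k$ occurrences of $p$. A run of $p$ is a maximal block of consecutive equal letters, and its size is its number of letters. Let $p$ be a binary word of length $l$ with $r$ runs, $r_i$ of which have size $i$ for each $i \ge 1$. Let $r_{3,b}$ be the number of runs of $p$ of size $3$ that are the first or the last run of $p$. Let $r_{(1,2),b} \in \{0,1,2\}$ be the number of words among $p$ and its reverse $p^r$ (counted as two words even if $p = p^r$) whose first two runs have sizes $1$ and $2$, in this order. Binomial coefficients $\binom{a}{b}$ with $a < 0$ are $0$. Proposition. Let $n \ge 5$. If $l \ge 4$, then $$B_{n,p}(4) = r_1 \binom{n-r-2}{l-r+1} + \binom{r_1}{2} \binom{n-r-1}{l-r+1} + (r_3 - r_{3,b}) \binom{n-r-1}{l-r} + r_{3,b} \binom{n-r}{l-r+1} + r_{(1,2),b}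 \binom{n-r-2}{l-r}.$$ If $1 \le l < 4$, then $$B_{n,p}(4) = \begin{cases} 0 & \text{if } l = 2,\ r = 1,\\ \binom{n}{4} & \text{if } l = 1 \text{ or } 3,\ r = 1,\\ (n-4)^2 & \text{if } l = 3,\ r = 2,\\ 5n - 19 & \text{if } l = 2,\ r = 2,\\ 7n - 31 & \text{if } l = 3,\ r = 3. \end{cases}$$ -/

import Mathlib

/-- A binary word is a finite sequence of letters `0` and `1` (here `false` and `true`). -/
abbrev BinaryWord : Type := List Bool

namespace BinaryWord

/-- An occurrence of `p` in `w`: a strictly increasing choice of indices of `w`, one for each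
letter of `p`, such that the letters of `w` at these indices spell `p`. -/
def Occurrence (p w : BinaryWord) : Type :=
  {f : Fin p.length ↪o Fin w.length // ∀ i, w.get (f i) = p.get i}

/-- `c_p(w)`, the number of occurrences of `p` in `w`. -/
noncomputable def occCount (p w : BinaryWord) : ℕ := Nat.card (Occurrence p w)

/-- The set of binary words of length `n` that have exactly `k` occurrences of `p`. -/
def wordsWithCount (n : ℕ) (p : BinaryWord) (k : ℕ) : Set BinaryWord :=
  {w | w.length = n ∧ occCount p w = k}

theorem wordsWithCount_finite (n : ℕ) (p : BinaryWord) (k : ℕ) :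
    (wordsWithCount n p k).Finite :=
  (List.finite_length_eq Bool n).subset fun _ hw => hw.1

/-- `B_{n,p}(k)`, the number of binary words of length `n` with exactly `k` occurrences of `p`. -/
noncomputable def B (n : ℕ) (p : BinaryWord) (k : ℕ) : ℕ := (wordsWithCount n p k).ncard

/-- The sizes of the runs (maximal blocks of consecutive equal letters) of `p`,
from left to right. -/
def runSizes (p : BinaryWord) : List ℕ := (p.splitBy (· == ·)).map List.length

/-- `r`, the number of runs of `p`. -/
def numRuns (p : BinaryWord) : ℕ := (runSizes p).length

/-- `r_i`, the number of runs of `p` of size `i`. -/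
def numRunsOfSize (p : BinaryWord) (i : ℕ) : ℕ := (runSizes p).count i

/-- `r_{i,b}`, the number of runs of `p` of size `i` that are the first or the last run of `p`
(a run that is both is counted once). -/
def numBoundaryRunsOfSize (p : BinaryWord) (i : ℕ) : ℕ :=
  ((Finset.range (numRuns p)).filter fun j =>
    (runSizes p)[j]? = some i ∧ (j = 0 ∨ j + 1 = numRuns p)).card

/-- The word has at least two runs, the first of size `1` and the second of size `2`. -/
def StartsOneTwo (p : BinaryWord) : Prop := (runSizes p).take 2 = [1, 2]

instance (p : BinaryWord) : Decidable (StartsOneTwo p) :=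
  inferInstanceAs (Decidable ((runSizes p).take 2 = [1, 2]))

/-- `r_{(1,2),b}`: how many of the two words `p` and its reverse start with a run of size `1`
followed by a run of size `2`. -/
def oneTwoBoundary (p : BinaryWord) : ℕ :=
  (if StartsOneTwo p then 1 else 0) + (if StartsOneTwo p.reverse then 1 else 0)

/-- The binomial coefficient `a choose b` of integers, equal to `0` when `a` or `b` is negative:
the number of `b`-element subsets of an `a`-element set. -/
def binom (a b : ℤ) : ℤ :=
  if 0 ≤ a ∧ 0 ≤ b then (a.toNat.choose b.toNat : ℤ) else 0

end BinaryWord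

/-!
The proof computes the generating function, by length, of the words with exactly four occurrences
of `p` and compares coefficients. Write `p = a :: q`, and let `y₀, y₁, y₂, …` be the numbers of
occurrences in a word `w` of `p` and of its successive tails, so that a positive `yᵢ` forces a
positive `yᵢ₊₁` (`occ_tail_pos`). Prepending a letter `b` to `w` adds `yᵢ₊₁` to every `yᵢ` whose
pattern starts with `b` (`occ`). Hence a set of words that is given by the values of finitely many
`yᵢ` has, after removal of the first letter, a description of the same kind with no larger values
(`gf_step`), and most of these descriptions are contradictory, above all because no word has
exactly one occurrence of `a :: q` and a positive number of `a :: a :: q` (`not_occ_pos_one`).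

The basic quantity is the series `jointGF a q 0 k` of the words with `y₀ = 0` and `y₁ = k`: put
behind a letter `a`, these are the words with `k` occurrences of `a :: q` all of which use that
letter. For `k = 1` it is `X ^ (l - 1) / (1 - X) ^ (l - r + 1)` (`jointGF_zero_one`). For `k = 4`
it satisfies a recursion along `p` that only multiplies by `X` or `X / (1 - X)` as long as nothing
happens, and that has a correction term, a multiple of the series for `k = 1` and `k = 2`, at each
run of size one or three and at a final pair of runs of sizes two and one. Solving it
(`jointGF_zero_four`) gives the series for `k = 1` times a weight that is a sum over runs: `4`
arises from a run of size one repeated four times, from two doubled runs of size one, from `aaa`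
inside `aaaa`, or from `abb` inside `ababb` at the boundary. The first run of `p` is put back by
one more application of the first-letter decomposition (`gf_occ_eq_four`), which for `l ≥ 4`
completes the weight to the symmetric `patternWeight` (`gf_occ_eq_four_of_length`). For `l ≤ 3` the
same recursions leave a few further terms, which are evaluated one pattern at a time. The binomial
coefficients are the coefficients of `X ^ a / (1 - X) ^ (b + 1)` (`coeff_X_pow_mul_geom_pow`).
-/

namespace BinaryWord

open PowerSeries

/-! ### A recursion for the number of occurrences -/

/-- The number of occurrences of `p` in `w`, by recursion on the first letter of `w`: an occurrence
either avoids that letter or uses it for the first letter of `p`. -/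
def occ : BinaryWord → BinaryWord → ℕ
  | [], _ => 1
  | _ :: _, [] => 0
  | a :: p, b :: w => occ (a :: p) w + if a = b then occ p w else 0

@[simp] theorem occ_nil_left (w : BinaryWord) : occ [] w = 1 := by
  cases w <;> rfl

@[simp] theorem occ_cons_nil (a : Bool) (p : BinaryWord) : occ (a :: p) [] = 0 := rfl

@[simp] theorem occ_cons_self (a : Bool) (p w : BinaryWord) :
    occ (a :: p) (a :: w) = occ (a :: p) w + occ p w := by simp [occ]

@[simp] theorem occ_cons_not (a : Bool) (p w : BinaryWord) :
    occ (a :: p) ((!a) :: w) = occ (a :: p) w := by simp [occ]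

@[simp] theorem occ_not_cons (a : Bool) (p w : BinaryWord) :
    occ ((!a) :: p) (a :: w) = occ ((!a) :: p) w := by simp [occ]

theorem occ_cons_of_head?_ne {p : BinaryWord} {b : Bool} (h : p.head? ≠ some b) (w : BinaryWord) :
    occ p (b :: w) = occ p w := by
  cases p with
  | nil => simp
  | cons a p => simp [occ, show a ≠ b by simpa using h]

theorem occ_le_occ_cons (p : BinaryWord) (b : Bool) (w : BinaryWord) :
    occ p w ≤ occ p (b :: w) := by
  cases p with
  | nil => simp
  | cons a p => simp [occ]

/-- A word that contains `a :: p` contains `p`. -/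
theorem occ_tail_pos {a : Bool} {p w : BinaryWord} (h : occ (a :: p) w ≠ 0) : occ p w ≠ 0 := by
  induction w with
  | nil => simp at h
  | cons b w ih =>
    have := occ_le_occ_cons p b w
    by_cases hab : a = b
    · simp only [occ, hab, if_true] at h
      subst hab
      rcases Nat.eq_zero_or_pos (occ p w) with h0 | h0
      · have := mt ih (by simpa using h0)
        omega
      · omega
    · simp only [occ, hab, if_false, add_zero] at h
      have := ih h
      omega

/-- An occurrence in `w`, read as an occurrence in `b :: w` that avoids the first letter. -/
def Occurrence.skip {p w : BinaryWord} (b : Bool) (g : Occurrence p w) : Occurrence p (b :: w) :=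
  ⟨OrderEmbedding.ofStrictMono (fun i => (g.1 i).succ)
    (fun _ _ hij => Fin.succ_lt_succ_iff.2 (g.1.strictMono hij)), fun i => g.2 i⟩

/-- An occurrence of `p` in `w`, extended to an occurrence of `a :: p` in `a :: w` that uses the
first letter. -/
def Occurrence.use {p w : BinaryWord} (a : Bool) (g : Occurrence p w) :
    Occurrence (a :: p) (a :: w) :=
  ⟨OrderEmbedding.ofStrictMono (Fin.cons (α := fun _ => Fin (w.length + 1)) 0
      (fun i => (g.1 i).succ))
    (fun i j hij => by
      cases i using Fin.cases with
      | zero =>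
        cases j using Fin.cases with
        | zero => exact absurd hij (lt_irrefl _)
        | succ j => exact Fin.succ_pos _
      | succ i =>
        cases j using Fin.cases with
        | zero => exact absurd hij (Fin.not_lt_zero _)
        | succ j => exact Fin.succ_lt_succ_iff.2 (g.1.strictMono (Fin.succ_lt_succ_iff.1 hij))),
    fun i => by
      cases i using Fin.cases with
      | zero => rfl
      | succ i => exact g.2 i⟩

theorem Occurrence.skip_injective {p w : BinaryWord} (b : Bool) :
    Function.Injective (Occurrence.skip b : Occurrence p w → _) := fun _ _ h =>
  Subtype.ext (DFunLike.ext _ _ fun i =>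
    Fin.succ_injective _ (DFunLike.congr_fun (congrArg Subtype.val h) i))

theorem Occurrence.use_injective {p w : BinaryWord} (a : Bool) :
    Function.Injective (Occurrence.use a : Occurrence p w → _) := fun _ _ h =>
  Subtype.ext (DFunLike.ext _ _ fun i =>
    Fin.succ_injective _ (DFunLike.congr_fun (congrArg Subtype.val h) i.succ))

theorem Occurrence.skip_ne_zero {a b : Bool} {p w : BinaryWord} (g : Occurrence (a :: p) w) :
    (g.skip b).1 0 ≠ 0 := Fin.succ_ne_zero _

theorem Occurrence.exists_skip {a b : Bool} {p w : BinaryWord} (f : Occurrence (a :: p) (b :: w))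
    (h : f.1 0 ≠ 0) : ∃ g : Occurrence (a :: p) w, g.skip b = f := by
  have hne : ∀ i, f.1 i ≠ 0 := fun i hi => by
    have := f.1.monotone (Fin.zero_le i)
    rw [hi] at this
    exact h (Fin.le_zero_iff.1 this)
  refine ⟨⟨OrderEmbedding.ofStrictMono (fun i => (f.1 i).pred (hne i))
    (fun i j hij => Fin.pred_lt_pred_iff.2 (f.1.strictMono hij)), fun i => ?_⟩, ?_⟩
  · have := f.2 i
    rw [← Fin.succ_pred (f.1 i) (hne i)] at this
    exact this
  · exact Subtype.ext (DFunLike.ext _ _ fun i => Fin.succ_pred _ (hne i))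

theorem Occurrence.exists_use {a : Bool} {p w : BinaryWord} (f : Occurrence (a :: p) (a :: w))
    (h : f.1 0 = 0) : ∃ g : Occurrence p w, g.use a = f := by
  have hne : ∀ i : Fin p.length, f.1 i.succ ≠ 0 := fun i hi => by
    have := f.1.strictMono (Fin.succ_pos i)
    rw [hi] at this
    exact Fin.not_lt_zero _ this
  refine ⟨⟨OrderEmbedding.ofStrictMono (fun i => (f.1 i.succ).pred (hne i))
    (fun i j hij => Fin.pred_lt_pred_iff.2 (f.1.strictMono (Fin.succ_lt_succ_iff.2 hij))),
    fun i => ?_⟩, ?_⟩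
  · have := f.2 i.succ
    rw [← Fin.succ_pred (f.1 i.succ) (hne i)] at this
    exact this
  · refine Subtype.ext (DFunLike.ext _ _ fun i => ?_)
    cases i using Fin.cases with
    | zero => exact h.symm
    | succ i => exact Fin.succ_pred _ (hne i)

instance (p w : BinaryWord) : Finite (Occurrence p w) := Subtype.finite

theorem occCount_eq_occ (p w : BinaryWord) : occCount p w = occ p w := by
  induction w generalizing p with
  | nil =>
    cases p with
    | nil =>
      have : Unique (Occurrence [] []) :=
        { default := ⟨RelEmbedding.refl _, fun i => i.elim0⟩
          uniq := fun f => Subtype.ext (DFunLike.ext _ _ fun i => i.elim0) }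
      simp [occCount]
    | cons a p =>
      have : IsEmpty (Occurrence (a :: p) []) := ⟨fun f => (f.1 0).elim0⟩
      simp [occCount]
  | cons b w ih =>
    cases p with
    | nil =>
      have : Unique (Occurrence [] (b :: w)) :=
        { default := ⟨OrderEmbedding.ofStrictMono (fun i => i.elim0) fun i => i.elim0,
            fun i => i.elim0⟩
          uniq := fun f => Subtype.ext (DFunLike.ext _ _ fun i => i.elim0) }
      simp [occCount]
    | cons a p =>
      by_cases hab : a = b
      · subst hab
        have hbij : Function.Bijective (Sum.elim (Occurrence.skip a) (Occurrence.use a) :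
            Occurrence (a :: p) w ⊕ Occurrence p w → Occurrence (a :: p) (a :: w)) := by
          constructor
          · refine (Occurrence.skip_injective a).sumElim (Occurrence.use_injective a)
              fun g g' h => ?_
            exact g.skip_ne_zero (b := a) (by rw [h]; rfl)
          · intro f
            by_cases h : f.1 0 = 0
            · obtain ⟨g, hg⟩ := f.exists_use h
              exact ⟨Sum.inr g, hg⟩
            · obtain ⟨g, hg⟩ := f.exists_skip h
              exact ⟨Sum.inl g, hg⟩
        rw [occCount, ← Nat.card_congr (Equiv.ofBijective _ hbij), Nat.card_sum, occ_cons_self]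
        exact congrArg₂ _ (ih _) (ih _)
      · have hbij : Function.Bijective
            (Occurrence.skip b : Occurrence (a :: p) w → Occurrence (a :: p) (b :: w)) := by
          refine ⟨Occurrence.skip_injective b, fun f => f.exists_skip fun h => hab ?_⟩
          have := f.2 0
          rw [h] at this
          exact this.symm
        rw [occCount, ← Nat.card_congr (Equiv.ofBijective _ hbij), occ, if_neg hab, add_zero]
        exact ih _

/-! ### Generating functions of sets of words -/

/-- The generating function, by length, of the words that satisfy `S`. -/
noncomputable def gf (S : BinaryWord → Prop) : ℤ⟦X⟧ :=
  PowerSeries.mk fun n => ({w : BinaryWord | w.length = n ∧ S w}.ncard : ℤ)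

/-- The power series `1 / (1 - X) = 1 + X + X ^ 2 + ⋯`. -/
noncomputable def geom : ℤ⟦X⟧ := PowerSeries.mk 1

theorem geom_mul_one_sub_X : geom * (1 - X) = 1 := mk_one_mul_one_sub_eq_one ℤ

theorem finite_length_and (n : ℕ) (S : BinaryWord → Prop) :
    {w : BinaryWord | w.length = n ∧ S w}.Finite :=
  (List.finite_length_eq Bool n).subset fun _ hw => hw.1

theorem gf_congr {S T : BinaryWord → Prop} (h : ∀ w, S w ↔ T w) : gf S = gf T := by
  rw [show S = T from funext fun w => propext (h w)]

theorem gf_eq_zero {S : BinaryWord → Prop} (h : ∀ w, ¬ S w) : gf S = 0 := by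
  ext n
  simp [gf, h]

theorem gf_or {S T : BinaryWord → Prop} (h : ∀ w, S w → ¬ T w) :
    gf (fun w => S w ∨ T w) = gf S + gf T := by
  ext n
  simp only [gf, coeff_mk, map_add]
  rw [← Nat.cast_add, ← Set.ncard_union_eq _ (finite_length_and n S) (finite_length_and n T)]
  · congr 2
    ext w
    simp only [Set.mem_ofPred_eq, Set.mem_union]
    tauto
  · rw [Set.disjoint_left]
    rintro w ⟨_, h1⟩ ⟨_, h2⟩
    exact h w h1 h2

theorem gf_eq_zero_add (S : BinaryWord → Prop) [Decidable (S [])] (a : Bool) :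
    gf S = (if S [] then 1 else 0) +
      X * (gf (fun w => S (a :: w)) + gf (fun w => S ((!a) :: w))) := by
  ext n
  cases n with
  | zero =>
    have : {w : BinaryWord | w.length = 0 ∧ S w} = if S [] then {[]} else ∅ := by
      split_ifs with h <;> ext w <;> cases w <;> simp [h]
    simp only [gf, coeff_mk, map_add, coeff_zero_X_mul, add_zero, this]
    split_ifs <;> simp
  | succ n =>
    have h0 : coeff (n + 1) (if S [] then (1 : ℤ⟦X⟧) else 0) = 0 := by
      split_ifs <;> simp [coeff_one]
    rw [map_add, h0, zero_add, coeff_succ_X_mul, map_add]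
    simp only [gf, coeff_mk]
    have h : {w : BinaryWord | w.length = n + 1 ∧ S w} =
        (List.cons a '' {w | w.length = n ∧ S (a :: w)}) ∪
          (List.cons (!a) '' {w | w.length = n ∧ S ((!a) :: w)}) := by
      ext w
      cases w with
      | nil => simp
      | cons b w => cases a <;> cases b <;> simp
    rw [h, Set.ncard_union_eq _ ((finite_length_and n _).image _) ((finite_length_and n _).image _),
      Set.ncard_image_of_injective _ List.cons_injective,
      Set.ncard_image_of_injective _ List.cons_injective, Nat.cast_add]
    rw [Set.disjoint_left]
    rintro _ ⟨u, _, rfl⟩ ⟨v, _, hv⟩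
    simp at hv

/-- The first-letter decomposition for a set of words that does not contain the empty word. -/
theorem gf_step {S A B : BinaryWord → Prop} (a : Bool) (h0 : ¬ S [])
    (hA : ∀ w, S (a :: w) ↔ A w) (hB : ∀ w, S ((!a) :: w) ↔ B w) :
    gf S = X * (gf A + gf B) := by
  classical
  rw [gf_eq_zero_add S a, if_neg h0, zero_add, gf_congr hA, gf_congr hB]

theorem gf_step_left {S A : BinaryWord → Prop} (a : Bool) (h0 : ¬ S [])
    (hA : ∀ w, S (a :: w) ↔ A w) (hB : ∀ w, ¬ S ((!a) :: w)) :
    gf S = X * gf A := by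
  rw [gf_step a h0 hA (B := fun _ => False) (by simpa using hB), gf_eq_zero (S := fun _ => False)
    (by simp), add_zero]

theorem gf_step_right {S B : BinaryWord → Prop} (a : Bool) (h0 : ¬ S [])
    (hA : ∀ w, ¬ S (a :: w)) (hB : ∀ w, S ((!a) :: w) ↔ B w) :
    gf S = X * gf B := by
  rw [gf_step a h0 (A := fun _ => False) (by simpa using hA) hB, gf_eq_zero (S := fun _ => False)
    (by simp), zero_add]

/-- The first-letter decomposition when the letter `!a` may be prepended freely. -/
theorem gf_step_loop {S A : BinaryWord → Prop} (a : Bool) (h0 : ¬ S [])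
    (hA : ∀ w, S (a :: w) ↔ A w) (hB : ∀ w, S ((!a) :: w) ↔ S w) :
    gf S = X * geom * gf A := by
  have h := gf_step a h0 hA hB
  linear_combination geom * h - gf S * geom_mul_one_sub_X

/-- No hypothesis `a ≤ n` is needed: for `n < a` the upper entry of the binomial coefficient is
negative or smaller than `b`. -/
theorem coeff_X_pow_mul_geom_pow (n a b : ℕ) :
    coeff n (X ^ a * geom ^ (b + 1)) = binom ((n : ℤ) - a + b) b := by
  rw [geom, mk_one_pow_eq_mk_choose_add, coeff_X_pow_mul']
  unfold binom
  split_ifs with h1 h2 h2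
  · rw [coeff_mk]
    have : ((n : ℤ) - a + b).toNat = b + (n - a) := by omega
    simp [this]
  · omega
  · have : ((n : ℤ) - a + b).toNat < b := by omega
    simp [Nat.choose_eq_zero_of_lt this]
  · rfl

theorem B_eq_coeff_gf (n : ℕ) (p : BinaryWord) (k : ℕ) :
    (B n p k : ℤ) = coeff n (gf fun w => occ p w = k) := by
  simp [B, wordsWithCount, gf, occCount_eq_occ]

/-! ### Joint counts of a pattern and its tails -/

/-- The generating function of the words with exactly `i` occurrences of `a :: q` and exactly `j`
occurrences of `q`. -/
noncomputable def jointGF (a : Bool) (q : BinaryWord) (i j : ℕ) : ℤ⟦X⟧ :=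
  gf fun w => occ (a :: q) w = i ∧ occ q w = j

theorem jointGF_singleton_one (a : Bool) : jointGF a [] 0 1 = geom := by
  have h := gf_eq_zero_add (fun w => occ [a] w = 0 ∧ occ [] w = 1) a
  rw [if_pos (by simp), gf_eq_zero (S := fun w => occ [a] (a :: w) = 0 ∧ occ [] (a :: w) = 1)
    (by simp), gf_congr (S := fun w => occ [a] ((!a) :: w) = 0 ∧ occ [] ((!a) :: w) = 1)
    (T := fun w => occ [a] w = 0 ∧ occ [] w = 1) (by simp)] at h
  unfold jointGF
  linear_combination geom * h -
    (gf fun w => occ [a] w = 0 ∧ occ [] w = 1) * geom_mul_one_sub_X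

theorem jointGF_singleton_of_ne_one (a : Bool) (i : ℕ) {j : ℕ} (hj : j ≠ 1) :
    jointGF a [] i j = 0 :=
  gf_eq_zero fun w h => hj (by simpa using h.2.symm)

theorem jointGF_cons_self (a : Bool) (q : BinaryWord) {k : ℕ} (hk : k ≠ 0) :
    jointGF a (a :: q) 0 k = X * geom * jointGF a q 0 k := by
  refine gf_step_loop a ?_ (fun w => ?_) (fun w => ?_)
  · simp only [occ_cons_nil]
    omega
  · have := @occ_tail_pos a (a :: q) w
    simp only [occ_cons_self]
    omega
  · simp only [occ_cons_not]

/-- If `q` does not start with `!a`, a letter `!a` in front of a word with `k` occurrences of `q`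
adds `k` occurrences of `(!a) :: q` and leaves those of `q` alone. -/
theorem gf_zero_of_add {a : Bool} {q : BinaryWord} (hq : q.head? ≠ some (!a)) {j : ℕ} (k : ℕ)
    (hj : j ≠ 0) :
    (gf fun w => occ (a :: (!a) :: q) w = 0 ∧ occ ((!a) :: q) w = j ∧ occ q w = k) =
      X * gf fun w => occ (a :: (!a) :: q) w = 0 ∧ occ ((!a) :: q) w + k = j ∧ occ q w = k := by
  refine gf_step_right a ?_ (fun w => ?_) (fun w => ?_)
  · simp only [occ_cons_nil]
    omega
  · simp only [occ_cons_self, occ_not_cons]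
    omega
  · simp only [occ_cons_self, occ_cons_not, occ_cons_of_head?_ne hq]
    omega

theorem gf_zero_self {a : Bool} {q : BinaryWord} (hq : q.head? ≠ some (!a)) {k : ℕ}
    (hk : k ≠ 0) :
    (gf fun w => occ (a :: (!a) :: q) w = 0 ∧ occ ((!a) :: q) w = k ∧ occ q w = k) =
      X * jointGF (!a) q 0 k := by
  rw [gf_zero_of_add hq k hk, jointGF]
  refine congrArg _ (gf_congr fun w => ?_)
  have := @occ_tail_pos a ((!a) :: q) w
  omega

theorem gf_zero_of_lt {a : Bool} {q : BinaryWord} (hq : q.head? ≠ some (!a)) {j k : ℕ}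
    (hj : j ≠ 0) (hk : j < k) :
    (gf fun w => occ (a :: (!a) :: q) w = 0 ∧ occ ((!a) :: q) w = j ∧ occ q w = k) = 0 := by
  rw [gf_zero_of_add hq k hj, gf_eq_zero fun w => ?_, mul_zero]
  omega

theorem gf_zero_three_one {a : Bool} {q : BinaryWord} (hq : q.head? ≠ some (!a)) :
    (gf fun w => occ (a :: (!a) :: q) w = 0 ∧ occ ((!a) :: q) w = 3 ∧ occ q w = 1) =
      X ^ 3 * jointGF (!a) q 0 1 := by
  rw [gf_zero_of_add hq 1 (by norm_num)]
  simp only [show ∀ x : ℕ, x + 1 = 3 ↔ x = 2 by omega]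
  rw [gf_zero_of_add hq 1 (by norm_num)]
  simp only [show ∀ x : ℕ, x + 1 = 2 ↔ x = 1 by omega]
  rw [gf_zero_self hq one_ne_zero]
  ring

/-- The first step for a pattern whose first run has size one. -/
theorem jointGF_zero_cons_not (a : Bool) (q : BinaryWord) {k : ℕ} (hk : k ≠ 0) :
    jointGF a ((!a) :: q) 0 k = X * gf fun w =>
      occ (a :: (!a) :: q) w = 0 ∧ occ ((!a) :: q) w + occ q w = k := by
  refine gf_step_right a ?_ (fun w => ?_) (fun w => ?_)
  · simp only [occ_cons_nil]
    omega
  · simp only [occ_cons_self, occ_not_cons]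
    omega
  · simp only [occ_cons_self, occ_cons_not]

theorem jointGF_one_cons_not (a : Bool) (q : BinaryWord) :
    jointGF a ((!a) :: q) 0 1 = X * jointGF (!a) q 0 1 := by
  rw [jointGF_zero_cons_not a q one_ne_zero, jointGF]
  refine congrArg _ (gf_congr fun w => ?_)
  have := @occ_tail_pos a ((!a) :: q) w
  have := @occ_tail_pos (!a) q w
  omega

theorem jointGF_two_cons_not (a : Bool) (q : BinaryWord) :
    jointGF a ((!a) :: q) 0 2 = X * (jointGF (!a) q 0 2 +
      gf fun w => occ (a :: (!a) :: q) w = 0 ∧ occ ((!a) :: q) w = 1 ∧ occ q w = 1) := by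
  rw [jointGF_zero_cons_not a q two_ne_zero, jointGF, ← gf_or (fun w => by omega)]
  refine congrArg _ (gf_congr fun w => ?_)
  have := @occ_tail_pos a ((!a) :: q) w
  have := @occ_tail_pos (!a) q w
  omega

theorem jointGF_four_cons_not (a : Bool) (q : BinaryWord) :
    jointGF a ((!a) :: q) 0 4 = X * (jointGF (!a) q 0 4 +
      ((gf fun w => occ (a :: (!a) :: q) w = 0 ∧ occ ((!a) :: q) w = 1 ∧ occ q w = 3) +
        ((gf fun w => occ (a :: (!a) :: q) w = 0 ∧ occ ((!a) :: q) w = 2 ∧ occ q w = 2) +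
          gf fun w => occ (a :: (!a) :: q) w = 0 ∧ occ ((!a) :: q) w = 3 ∧ occ q w = 1))) := by
  rw [jointGF_zero_cons_not a q four_ne_zero, jointGF, ← gf_or (fun w => by omega),
    ← gf_or (fun w => by omega), ← gf_or (fun w => by omega)]
  refine congrArg _ (gf_congr fun w => ?_)
  have := @occ_tail_pos a ((!a) :: q) w
  have := @occ_tail_pos (!a) q w
  omega

/-! ### Second run of size one -/

theorem jointGF_two_cons_not_of_single {a : Bool} {q : BinaryWord} (hq : q.head? ≠ some (!a)) :
    jointGF a ((!a) :: q) 0 2 =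
      X * (jointGF (!a) q 0 2 + X * jointGF (!a) q 0 1) := by
  rw [jointGF_two_cons_not, gf_zero_self hq one_ne_zero]

theorem jointGF_four_cons_not_of_single {a : Bool} {q : BinaryWord}
    (hq : q.head? ≠ some (!a)) :
    jointGF a ((!a) :: q) 0 4 = X * (jointGF (!a) q 0 4 + X * jointGF (!a) q 0 2 +
      X ^ 3 * jointGF (!a) q 0 1) := by
  rw [jointGF_four_cons_not, gf_zero_of_lt hq one_ne_zero (by norm_num),
    gf_zero_self hq two_ne_zero, gf_zero_three_one hq]
  ring

/-! ### Impossible joint counts -/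

@[elab_as_elim]
theorem forall_word {P : BinaryWord → Prop} (a : Bool) (h0 : P []) (hA : ∀ w, P w → P (a :: w))
    (hB : ∀ w, P w → P ((!a) :: w)) (w : BinaryWord) : P w := by
  induction w with
  | nil => exact h0
  | cons b w ih =>
    rcases Bool.eq_or_eq_not b a with rfl | rfl
    · exact hA w ih
    · exact hB w ih

/-- An occurrence of `a :: a :: q` contains two different occurrences of `a :: q`. -/
theorem not_occ_pos_one (a : Bool) (q w : BinaryWord) :
    ¬ (occ (a :: a :: q) w ≠ 0 ∧ occ (a :: q) w = 1) := by
  refine forall_word a (by simp) (fun w _ => ?_) (fun w hw => ?_) w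
  · have := @occ_tail_pos a (a :: q) w
    have := @occ_tail_pos a q w
    simp only [occ_cons_self]
    omega
  · simpa only [occ_cons_not] using hw

theorem not_occ_two_two (a : Bool) (q w : BinaryWord) :
    ¬ (occ (a :: a :: q) w = 2 ∧ occ (a :: q) w = 2) := by
  refine forall_word a (by simp) (fun w _ => ?_) (fun w hw => ?_) w
  · have := not_occ_pos_one a q w
    have := @occ_tail_pos a (a :: q) w
    have := @occ_tail_pos a q w
    simp only [occ_cons_self]
    omega
  · simpa only [occ_cons_not] using hw

theorem not_occ_zero_one_one_one (a b : Bool) (q w : BinaryWord) :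
    ¬ (occ (a :: a :: (!a) :: b :: q) w = 0 ∧ occ (a :: (!a) :: b :: q) w = 1 ∧
      occ ((!a) :: b :: q) w = 1 ∧ occ (b :: q) w = 1) := by
  refine forall_word a (by simp) (fun w _ => ?_) (fun w _ => ?_) w
  · have := @occ_tail_pos (!a) (b :: q) w
    have := @occ_tail_pos b q w
    rcases Bool.eq_or_eq_not b a with rfl | rfl
    · simp only [occ_cons_self, occ_not_cons]
      omega
    · have := not_occ_pos_one (!a) q w
      simp only [occ_cons_self, occ_not_cons]
      omega
  · have := @occ_tail_pos a ((!a) :: b :: q) w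
    have := @occ_tail_pos (!a) (b :: q) w
    simp only [occ_cons_self, occ_cons_not]
    omega

theorem not_occ_alternating_two_one_one (a : Bool) (q w : BinaryWord) :
    ¬ (occ (a :: (!a) :: a :: q) w = 2 ∧ occ ((!a) :: a :: q) w = 1 ∧ occ (a :: q) w = 1) := by
  refine forall_word a (by simp) (fun w _ => ?_) (fun w _ => ?_) w
  · have := @occ_tail_pos (!a) (a :: q) w
    have := @occ_tail_pos a q w
    simp only [occ_cons_self, occ_not_cons]
    omega
  · have := @occ_tail_pos a ((!a) :: a :: q) w
    simp only [occ_cons_self, occ_cons_not]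
    omega

theorem not_occ_alternating_one_one_one (a : Bool) (q w : BinaryWord) :
    ¬ (occ (a :: (!a) :: a :: q) w = 1 ∧ occ ((!a) :: a :: q) w = 1 ∧ occ (a :: q) w = 1) := by
  refine forall_word a (by simp) (fun w _ => ?_) (fun w _ => ?_) w
  · have := @occ_tail_pos (!a) (a :: q) w
    have := @occ_tail_pos a q w
    simp only [occ_cons_self, occ_not_cons]
    omega
  · have := @occ_tail_pos a ((!a) :: a :: q) w
    simp only [occ_cons_self, occ_cons_not]
    omega

theorem not_occ_alternating_one_two_one (a : Bool) (q w : BinaryWord) :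
    ¬ (occ (a :: (!a) :: a :: q) w = 1 ∧ occ ((!a) :: a :: q) w = 2 ∧ occ (a :: q) w = 1) := by
  refine forall_word a (by simp) (fun w _ => ?_) (fun w _ => ?_) w
  · have := @occ_tail_pos (!a) (a :: q) w
    have := @occ_tail_pos a q w
    simp only [occ_cons_self, occ_not_cons]
    omega
  · have := not_occ_alternating_one_one_one a q w
    simp only [occ_cons_self, occ_cons_not]
    omega

theorem not_occ_alternating_zero_one_one_one (a b : Bool) (q w : BinaryWord) :
    ¬ (occ (a :: (!a) :: a :: b :: q) w = 0 ∧ occ ((!a) :: a :: b :: q) w = 1 ∧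
      occ (a :: b :: q) w = 1 ∧ occ (b :: q) w = 1) := by
  refine forall_word a (by simp) (fun w _ => ?_) (fun w _ => ?_) w
  · simp only [occ_cons_self, occ_not_cons]
    omega
  · have := @occ_tail_pos a (b :: q) w
    have := @occ_tail_pos b q w
    rcases Bool.eq_or_eq_not b a with rfl | rfl
    · have := not_occ_pos_one b q w
      simp only [occ_cons_self, occ_cons_not]
      omega
    · simp only [occ_cons_self, occ_cons_not]
      omega

theorem not_occ_alternating_one_one_two (a b : Bool) (q w : BinaryWord) :
    ¬ (occ (a :: (!a) :: a :: b :: q) w = 1 ∧ occ ((!a) :: a :: b :: q) w = 1 ∧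
      occ (a :: b :: q) w = 2) := by
  refine forall_word a (by simp) (fun w _ => ?_) (fun w _ => ?_) w
  · have := @occ_tail_pos (!a) (a :: b :: q) w
    have := @occ_tail_pos a (b :: q) w
    have := not_occ_alternating_zero_one_one_one a b q w
    simp only [occ_cons_self, occ_not_cons]
    omega
  · simp only [occ_cons_self, occ_cons_not]
    omega

/-! ### Second run of size at least two -/

/-- The generating function of the words with no occurrence of `a :: a :: q`, one of `a :: q` and
two of `q`. -/
noncomputable def doubleGF (a : Bool) (q : BinaryWord) : ℤ⟦X⟧ :=
  gf fun w => occ (a :: a :: q) w = 0 ∧ occ (a :: q) w = 1 ∧ occ q w = 2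

/-- For a second run of size at least two, the only source of four occurrences besides
`jointGF (!a) ((!a) :: q) 0 4`. -/
theorem gf_zero_one_three (a : Bool) (q : BinaryWord) :
    (gf fun w => occ (a :: (!a) :: (!a) :: q) w = 0 ∧ occ ((!a) :: (!a) :: q) w = 1 ∧
      occ ((!a) :: q) w = 3) = X * doubleGF (!a) q := by
  refine gf_step_right a (by simp) (fun w => ?_) (fun w => ?_)
  · simp only [occ_cons_self, occ_not_cons]
    omega
  · have := @occ_tail_pos a ((!a) :: (!a) :: q) w
    have := @occ_tail_pos (!a) ((!a) :: q) w
    have := @occ_tail_pos (!a) q w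
    simp only [occ_cons_self, occ_cons_not]
    omega

theorem gf_zero_one_two (a : Bool) (q : BinaryWord) :
    (gf fun w => occ (a :: (!a) :: (!a) :: q) w = 0 ∧ occ ((!a) :: (!a) :: q) w = 1 ∧
      occ ((!a) :: q) w = 2) =
      X * gf fun w => occ ((!a) :: (!a) :: q) w = 0 ∧ occ ((!a) :: q) w = 1 ∧ occ q w = 1 := by
  refine gf_step_right a (by simp) (fun w => ?_) (fun w => ?_)
  · simp only [occ_cons_self, occ_not_cons]
    omega
  · have := @occ_tail_pos a ((!a) :: (!a) :: q) w
    have := @occ_tail_pos (!a) ((!a) :: q) w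
    have := @occ_tail_pos (!a) q w
    simp only [occ_cons_self, occ_cons_not]
    omega

theorem jointGF_four_cons_not_not (a : Bool) (q : BinaryWord) :
    jointGF a ((!a) :: (!a) :: q) 0 4 =
      X * (jointGF (!a) ((!a) :: q) 0 4 + X * doubleGF (!a) q) := by
  rw [jointGF_four_cons_not, gf_zero_one_three, gf_eq_zero fun w h => not_occ_two_two (!a) q w h.2,
    gf_eq_zero fun w h => not_occ_pos_one (!a) q w ⟨by omega, h.2.2⟩, add_zero, add_zero]

theorem jointGF_two_cons_not_not (a : Bool) (q : BinaryWord) :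
    jointGF a ((!a) :: (!a) :: q) 0 2 = X * jointGF (!a) ((!a) :: q) 0 2 := by
  rw [jointGF_two_cons_not, gf_eq_zero fun w h => not_occ_pos_one (!a) q w ⟨by omega, h.2.2⟩,
    add_zero]

theorem doubleGF_nil (a : Bool) : doubleGF a [] = 0 :=
  gf_eq_zero fun w => by simp

theorem doubleGF_cons_not (a : Bool) (q : BinaryWord) :
    doubleGF a ((!a) :: q) = X * gf fun w => occ (a :: a :: (!a) :: q) w = 0 ∧
      occ (a :: (!a) :: q) w = 1 ∧ occ ((!a) :: q) w = 1 ∧ occ q w = 1 := by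
  refine gf_step_right a (by simp) (fun w => ?_) (fun w => ?_)
  · simp only [occ_cons_self, occ_not_cons]
    omega
  · simp only [occ_cons_self, occ_cons_not]
    have := @occ_tail_pos a ((!a) :: q) w
    have := @occ_tail_pos (!a) q w
    omega

theorem doubleGF_cons_not_cons (a b : Bool) (q : BinaryWord) :
    doubleGF a ((!a) :: b :: q) = 0 := by
  rw [doubleGF_cons_not, gf_eq_zero (not_occ_zero_one_one_one a b q), mul_zero]

theorem doubleGF_not (a : Bool) : doubleGF a [!a] = X ^ 2 * jointGF a [!a] 0 1 := by
  rw [doubleGF_cons_not, pow_two, mul_assoc]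
  refine congrArg _ (gf_step_left a (by simp) (fun w => ?_) (fun w => ?_))
  · have := @occ_tail_pos a [a, !a] w
    have := @occ_tail_pos a [!a] w
    simp only [occ_cons_self, occ_not_cons, occ_nil_left, and_true]
    omega
  · have := @occ_tail_pos a [!a] w
    simp only [occ_cons_self, occ_cons_not, occ_nil_left, and_true]
    omega

theorem doubleGF_cons_self (a : Bool) (q : BinaryWord) :
    doubleGF a (a :: q) = X * geom *
      gf fun w => occ (a :: a :: q) w = 0 ∧ occ (a :: q) w = 1 ∧ occ q w = 1 := by
  refine gf_step_loop a (by simp) (fun w => ?_) (fun w => ?_)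
  · have := @occ_tail_pos a (a :: a :: q) w
    have := @occ_tail_pos a (a :: q) w
    have := @occ_tail_pos a q w
    simp only [occ_cons_self]
    omega
  · simp only [occ_cons_not]

theorem gf_cons_cons_zero_one_one_nil (a : Bool) :
    (gf fun w => occ [a, a] w = 0 ∧ occ [a] w = 1 ∧ occ [] w = 1) =
      X * geom * jointGF a [] 0 1 := by
  refine gf_step_loop a (by simp) (fun w => ?_) (fun w => ?_)
  · have := @occ_tail_pos a [a] w
    simp only [occ_cons_self, occ_nil_left, and_true]
    omega
  · simp only [occ_cons_not, occ_nil_left, and_true]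

theorem gf_cons_cons_zero_one_one_cons_not (a : Bool) (q : BinaryWord) :
    (gf fun w => occ (a :: a :: (!a) :: q) w = 0 ∧ occ (a :: (!a) :: q) w = 1 ∧
      occ ((!a) :: q) w = 1) = X * jointGF a ((!a) :: q) 0 1 := by
  refine gf_step_left a (by simp) (fun w => ?_) (fun w => ?_)
  · have := @occ_tail_pos a (a :: (!a) :: q) w
    have := @occ_tail_pos a ((!a) :: q) w
    simp only [occ_cons_self, occ_not_cons]
    omega
  · have := @occ_tail_pos a ((!a) :: q) w
    have := @occ_tail_pos (!a) q w
    simp only [occ_cons_self, occ_cons_not]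
    omega

theorem doubleGF_triple (a : Bool) : doubleGF a [a] = X ^ 2 * geom ^ 2 * jointGF a [] 0 1 := by
  rw [doubleGF_cons_self, gf_cons_cons_zero_one_one_nil]
  ring

theorem doubleGF_triple_not (a : Bool) (q : BinaryWord) :
    doubleGF a (a :: (!a) :: q) = X ^ 2 * geom * jointGF a ((!a) :: q) 0 1 := by
  rw [doubleGF_cons_self, gf_cons_cons_zero_one_one_cons_not]
  ring

theorem doubleGF_quadruple (a : Bool) (q : BinaryWord) : doubleGF a (a :: a :: q) = 0 := by
  rw [doubleGF_cons_self, gf_eq_zero fun w h => not_occ_pos_one a q w ⟨by omega, h.2.2⟩, mul_zero]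

/-! ### The first run -/

/-- A word with four occurrences starts with letters `!a`, which are irrelevant, and a letter `a`;
the four occurrences split into those that avoid and those that use this `a`. -/
theorem gf_occ_eq_four (a : Bool) (q : BinaryWord) :
    (gf fun w => occ (a :: q) w = 4) = X * geom *
      (jointGF a q 0 4 + (jointGF a q 1 3 + (jointGF a q 2 2 + jointGF a q 3 1))) := by
  unfold jointGF
  rw [← gf_or (fun w => by omega), ← gf_or (fun w => by omega), ← gf_or (fun w => by omega)]
  refine gf_step_loop a (by simp) (fun w => ?_) (fun w => ?_)
  · have := @occ_tail_pos a q w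
    simp only [occ_cons_self]
    omega
  · simp only [occ_cons_not]

theorem gf_occ_cons_self_eq_four (a : Bool) (q : BinaryWord) :
    (gf fun w => occ (a :: a :: q) w = 4) = X * geom *
      (jointGF a (a :: q) 0 4 + X * geom * doubleGF a q) := by
  have h13 : jointGF a (a :: q) 1 3 = X * geom * doubleGF a q := by
    refine gf_step_loop a (by simp) (fun w => ?_) (fun w => ?_)
    · have := @occ_tail_pos a (a :: q) w
      have := @occ_tail_pos a q w
      simp only [occ_cons_self]
      omega
    · simp only [occ_cons_not]
  have h22 : jointGF a (a :: q) 2 2 = 0 := gf_eq_zero (not_occ_two_two a q)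
  have h31 : jointGF a (a :: q) 3 1 = 0 :=
    gf_eq_zero fun w h => not_occ_pos_one a q w ⟨by omega, h.2⟩
  rw [gf_occ_eq_four, h13, h22, h31, add_zero, add_zero]

theorem jointGF_succ_one_cons_not (a : Bool) (q : BinaryWord) (i : ℕ) :
    jointGF a ((!a) :: q) (i + 1) 1 = X * jointGF a ((!a) :: q) i 1 := by
  refine gf_step_left a (by simp) (fun w => ?_) (fun w => ?_)
  · simp only [occ_cons_self, occ_not_cons]
    omega
  · have := @occ_tail_pos a ((!a) :: q) w
    have := @occ_tail_pos (!a) q w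
    simp only [occ_cons_self, occ_cons_not]
    omega

theorem jointGF_two_two_cons_not (a : Bool) (q : BinaryWord) :
    jointGF a ((!a) :: q) 2 2 = X * (jointGF a ((!a) :: q) 0 2 +
      gf fun w => occ (a :: (!a) :: q) w = 2 ∧ occ ((!a) :: q) w = 1 ∧ occ q w = 1) := by
  refine gf_step a (by simp) (fun w => ?_) (fun w => ?_)
  · simp only [occ_cons_self, occ_not_cons]
    omega
  · have := @occ_tail_pos a ((!a) :: q) w
    have := @occ_tail_pos (!a) q w
    simp only [occ_cons_self, occ_cons_not]
    omega

theorem jointGF_one_three_cons_not (a : Bool) (q : BinaryWord) :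
    jointGF a ((!a) :: q) 1 3 = X *
      ((gf fun w => occ (a :: (!a) :: q) w = 1 ∧ occ ((!a) :: q) w = 1 ∧ occ q w = 2) +
        gf fun w => occ (a :: (!a) :: q) w = 1 ∧ occ ((!a) :: q) w = 2 ∧ occ q w = 1) := by
  rw [← gf_or (fun w => by omega)]
  refine gf_step_right a (by simp) (fun w => ?_) (fun w => ?_)
  · simp only [occ_cons_self, occ_not_cons]
    omega
  · have := @occ_tail_pos a ((!a) :: q) w
    have := @occ_tail_pos (!a) q w
    simp only [occ_cons_self, occ_cons_not]
    omega

theorem gf_occ_cons_not_eq_four (a : Bool) (q : BinaryWord) :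
    (gf fun w => occ (a :: (!a) :: q) w = 4) = X * geom *
      (jointGF a ((!a) :: q) 0 4 + X * jointGF a ((!a) :: q) 0 2 +
        X ^ 3 * jointGF a ((!a) :: q) 0 1 +
        X * ((gf fun w => occ (a :: (!a) :: q) w = 2 ∧ occ ((!a) :: q) w = 1 ∧ occ q w = 1) +
          (gf fun w => occ (a :: (!a) :: q) w = 1 ∧ occ ((!a) :: q) w = 1 ∧ occ q w = 2) +
          gf fun w => occ (a :: (!a) :: q) w = 1 ∧ occ ((!a) :: q) w = 2 ∧ occ q w = 1)) := by
  rw [gf_occ_eq_four, jointGF_succ_one_cons_not, jointGF_succ_one_cons_not,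
    jointGF_succ_one_cons_not, jointGF_two_two_cons_not, jointGF_one_three_cons_not]
  ring

theorem gf_occ_alternating_eq_four (a b : Bool) (q : BinaryWord) :
    (gf fun w => occ (a :: (!a) :: a :: b :: q) w = 4) = X * geom *
      (jointGF a ((!a) :: a :: b :: q) 0 4 + X * jointGF a ((!a) :: a :: b :: q) 0 2 +
        X ^ 3 * jointGF a ((!a) :: a :: b :: q) 0 1) := by
  rw [gf_occ_cons_not_eq_four, gf_eq_zero (not_occ_alternating_two_one_one a (b :: q)),
    gf_eq_zero (not_occ_alternating_one_two_one a (b :: q)),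
    gf_eq_zero (not_occ_alternating_one_one_two a b q)]
  ring

theorem gf_occ_cons_not_not_eq_four (a : Bool) (q : BinaryWord) :
    (gf fun w => occ (a :: (!a) :: (!a) :: q) w = 4) = X * geom *
      (jointGF a ((!a) :: (!a) :: q) 0 4 + X * jointGF a ((!a) :: (!a) :: q) 0 2 +
        X ^ 3 * jointGF a ((!a) :: (!a) :: q) 0 1 +
        X ^ 3 * gf fun w => occ ((!a) :: (!a) :: q) w = 0 ∧ occ ((!a) :: q) w = 1 ∧
          occ q w = 1) := by
  have h112 : (gf fun w => occ (a :: (!a) :: (!a) :: q) w = 1 ∧ occ ((!a) :: (!a) :: q) w = 1 ∧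
      occ ((!a) :: q) w = 2) = X * gf fun w => occ (a :: (!a) :: (!a) :: q) w = 0 ∧
        occ ((!a) :: (!a) :: q) w = 1 ∧ occ ((!a) :: q) w = 2 := by
    refine gf_step_left a (by simp) (fun w => ?_) (fun w => ?_)
    · simp only [occ_cons_self, occ_not_cons]
      omega
    · have := @occ_tail_pos a ((!a) :: (!a) :: q) w
      have := @occ_tail_pos (!a) ((!a) :: q) w
      simp only [occ_cons_self, occ_cons_not]
      omega
  have h211 : (gf fun w => occ (a :: (!a) :: (!a) :: q) w = 2 ∧ occ ((!a) :: (!a) :: q) w = 1 ∧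
      occ ((!a) :: q) w = 1) = 0 :=
    gf_eq_zero fun w h => not_occ_pos_one (!a) q w ⟨by omega, h.2.2⟩
  have h121 : (gf fun w => occ (a :: (!a) :: (!a) :: q) w = 1 ∧ occ ((!a) :: (!a) :: q) w = 2 ∧
      occ ((!a) :: q) w = 1) = 0 :=
    gf_eq_zero fun w h => not_occ_pos_one (!a) q w ⟨by omega, h.2.2⟩
  rw [gf_occ_cons_not_eq_four, h112, h211, h121, gf_zero_one_two]
  ring

/-! ### Patterns of length at most three -/

theorem gf_occ_singleton (a : Bool) (k : ℕ) :
    (gf fun w => occ [a] w = k) = X ^ k * geom ^ (k + 1) := by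
  induction k with
  | zero => simpa [jointGF] using jointGF_singleton_one a
  | succ k ih =>
    rw [gf_step_loop a (A := fun w => occ [a] w = k) (by simp) (by simp) (by simp), ih]
    ring

theorem gf_occ_pair_self (a : Bool) : (gf fun w => occ [a, a] w = 4) = 0 := by
  rw [gf_occ_cons_self_eq_four, jointGF_cons_self a [] four_ne_zero,
    jointGF_singleton_of_ne_one a 0 (by norm_num), doubleGF_nil]
  ring

theorem gf_occ_triple_self (a : Bool) :
    (gf fun w => occ [a, a, a] w = 4) = X ^ 4 * geom ^ 5 := by
  rw [gf_occ_cons_self_eq_four, jointGF_cons_self a [a] four_ne_zero,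
    jointGF_cons_self a [] four_ne_zero,
    jointGF_singleton_of_ne_one a 0 (by norm_num), doubleGF_triple, jointGF_singleton_one]
  ring

theorem gf_occ_pair_not (a : Bool) :
    (gf fun w => occ [a, !a] w = 4) = X ^ 4 * geom ^ 2 + 4 * (X ^ 5 * geom ^ 2) := by
  have h211 : (gf fun w => occ [a, !a] w = 2 ∧ occ [!a] w = 1 ∧ occ [] w = 1) =
      jointGF a [!a] 2 1 := gf_congr (by simp)
  have h112 : (gf fun w => occ [a, !a] w = 1 ∧ occ [!a] w = 1 ∧ occ [] w = 2) = 0 :=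
    gf_eq_zero (by simp)
  have h121 : (gf fun w => occ [a, !a] w = 1 ∧ occ [!a] w = 2 ∧ occ [] w = 1) =
      X * jointGF a [!a] 1 1 := by
    refine gf_step_right a (by simp) (fun w => ?_) (fun w => ?_)
    · simp only [occ_cons_self, occ_not_cons]
      omega
    · simp only [occ_cons_self, occ_cons_not, occ_nil_left, and_true]
      omega
  rw [gf_occ_cons_not_eq_four, h211, h112, h121, jointGF_succ_one_cons_not,
    jointGF_succ_one_cons_not, jointGF_four_cons_not_of_single (by simp),
    jointGF_two_cons_not_of_single (by simp), jointGF_one_cons_not,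
    jointGF_singleton_of_ne_one _ 0 (by norm_num), jointGF_singleton_of_ne_one _ 0 (by norm_num),
    jointGF_singleton_one]
  ring

theorem gf_occ_cons_self_not (a : Bool) :
    (gf fun w => occ [a, a, !a] w = 4) = X ^ 5 * geom ^ 3 + X ^ 6 * geom ^ 3 := by
  rw [gf_occ_cons_self_eq_four, jointGF_cons_self a [!a] four_ne_zero,
    jointGF_four_cons_not_of_single (by simp), doubleGF_not, jointGF_one_cons_not,
    jointGF_singleton_of_ne_one _ 0 (by norm_num), jointGF_singleton_of_ne_one _ 0 (by norm_num),
    jointGF_singleton_one]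
  ring

theorem gf_occ_cons_not_not (a : Bool) :
    (gf fun w => occ [a, !a, !a] w = 4) = X ^ 5 * geom ^ 3 + X ^ 6 * geom ^ 3 := by
  rw [gf_occ_cons_not_not_eq_four, gf_cons_cons_zero_one_one_nil, jointGF_four_cons_not_not,
    jointGF_two_cons_not_not, jointGF_one_cons_not, doubleGF_nil,
    jointGF_cons_self _ _ one_ne_zero, jointGF_cons_self _ _ two_ne_zero,
    jointGF_cons_self _ _ four_ne_zero,
    jointGF_singleton_of_ne_one _ 0 (by norm_num), jointGF_singleton_of_ne_one _ 0 (by norm_num),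
    jointGF_singleton_one]
  ring

theorem gf_occ_alternating (a : Bool) :
    (gf fun w => occ [a, !a, a] w = 4) = 4 * (X ^ 5 * geom ^ 2) + 3 * (X ^ 6 * geom ^ 2) := by
  have h112 : (gf fun w => occ [a, !a, a] w = 1 ∧ occ [!a, a] w = 1 ∧ occ [a] w = 2) =
      X * gf fun w => occ [a, !a, a] w = 0 ∧ occ [!a, a] w = 1 ∧ occ [a] w = 1 := by
    refine gf_step_left a (by simp) (fun w => ?_) (fun w => ?_)
    · have := @occ_tail_pos (!a) [a] w
      simp only [occ_cons_self, occ_not_cons, occ_nil_left]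
      omega
    · simp only [occ_cons_self, occ_cons_not]
      omega
  have h1 := jointGF_one_cons_not (!a) []
  have h2 := jointGF_two_cons_not_of_single (a := !a) (q := []) (by simp)
  have h4 := jointGF_four_cons_not_of_single (a := !a) (q := []) (by simp)
  simp only [Bool.not_not] at h1 h2 h4
  rw [gf_occ_cons_not_eq_four, gf_eq_zero (not_occ_alternating_two_one_one a []),
    gf_eq_zero (not_occ_alternating_one_two_one a []), h112, gf_zero_self (by simp) one_ne_zero,
    jointGF_four_cons_not_of_single (by simp), jointGF_two_cons_not_of_single (by simp),
    jointGF_one_cons_not, h1, h2, h4,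
    jointGF_singleton_of_ne_one _ 0 (by norm_num), jointGF_singleton_of_ne_one _ 0 (by norm_num),
    jointGF_singleton_one]
  ring

/-! ### Run sizes -/

/-- The accumulator `a :: g` of the loop behind `List.splitBy` is an unfinished run, and `gs` are
the finished ones. -/
theorem map_length_splitBy_loop (q : BinaryWord) (a : Bool) (g : BinaryWord)
    (gs : List BinaryWord) :
    (List.splitBy.loop (· == ·) q a g gs).map List.length =
      (gs.reverse.map List.length) ++ (runSizes (a :: q)).modifyHead (· + g.length) := by
  induction q generalizing a g gs with
  | nil => simp [List.splitBy.loop, runSizes, List.splitBy, Nat.add_comm]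
  | cons b q ih =>
    by_cases hab : a = b
    · subst hab
      simp only [List.splitBy.loop, beq_self_eq_true, runSizes, List.splitBy]
      rw [ih, ih]
      cases runSizes (a :: q) <;> simp; try omega
    · have h : (a == b) = false := by simpa using hab
      simp only [List.splitBy.loop, h, runSizes, List.splitBy]
      rw [ih, ih]
      cases runSizes (b :: q) <;> simp [Nat.add_comm]

@[simp] theorem runSizes_singleton (a : Bool) : runSizes [a] = [1] := rfl

theorem runSizes_cons_self (a : Bool) (q : BinaryWord) :
    runSizes (a :: a :: q) = (runSizes (a :: q)).modifyHead (· + 1) := by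
  have h := map_length_splitBy_loop q a [a] []
  simpa [runSizes, List.splitBy, List.splitBy.loop] using h

theorem runSizes_cons_not (a : Bool) (q : BinaryWord) :
    runSizes (a :: (!a) :: q) = 1 :: runSizes ((!a) :: q) := by
  have h := map_length_splitBy_loop q (!a) [] [[a]]
  have h' : ∀ l : List ℕ, l.modifyHead (fun x => x) = l := fun l => by cases l <;> rfl
  simpa [runSizes, List.splitBy, List.splitBy.loop, h'] using h

theorem exists_runSizes_cons (a : Bool) (q : BinaryWord) :
    ∃ s t, runSizes (a :: q) = (s + 1) :: t := by
  induction q generalizing a with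
  | nil => exact ⟨0, [], rfl⟩
  | cons b q ih =>
    rcases Bool.eq_or_eq_not b a with rfl | rfl
    · obtain ⟨s, t, h⟩ := ih b
      exact ⟨s + 1, t, by rw [runSizes_cons_self, h]; rfl⟩
    · exact ⟨0, _, runSizes_cons_not a q⟩

theorem numRuns_le_length (p : BinaryWord) : p.numRuns ≤ p.length := by
  induction p with
  | nil => simp [numRuns, runSizes]
  | cons a p ih =>
    cases p with
    | nil => simp [numRuns]
    | cons b p =>
      unfold numRuns at ih ⊢
      rcases Bool.eq_or_eq_not b a with rfl | rfl
      · rw [runSizes_cons_self, List.length_modifyHead]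
        exact ih.trans (Nat.le_succ _)
      · rw [runSizes_cons_not]
        exact Nat.succ_le_succ ih

theorem startsOneTwo_iff (a b c d : Bool) (q : BinaryWord) :
    StartsOneTwo (a :: b :: c :: d :: q) ↔ b = (!a) ∧ c = (!a) ∧ d = a := by
  obtain ⟨s, t, h⟩ := exists_runSizes_cons d q
  have hf : ∀ p, runSizes (true :: false :: p) = 1 :: runSizes (false :: p) :=
    runSizes_cons_not true
  have ht : ∀ p, runSizes (false :: true :: p) = 1 :: runSizes (true :: p) :=
    runSizes_cons_not false
  unfold StartsOneTwo
  cases a <;> cases b <;> cases c <;> cases d <;> simp [runSizes_cons_self, hf, ht, h]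

/-- The last two runs of `p` have sizes `2` and `1`, in this order, and they are not all of `p`. -/
def EndsTwoOne (p : BinaryWord) : Prop := 4 ≤ p.length ∧ StartsOneTwo p.reverse

instance (p : BinaryWord) : Decidable (EndsTwoOne p) :=
  inferInstanceAs (Decidable (_ ∧ _))

/-- A letter in front of a word does not change whether it ends with runs of sizes `2` and `1`,
except that it may complete these two runs to a word of length `4`. -/
theorem endsTwoOne_cons_iff (a : Bool) (p : BinaryWord) :
    EndsTwoOne (a :: p) ↔ EndsTwoOne p ∨ p = [!a, !a, a] := by
  unfold EndsTwoOne
  rw [List.reverse_cons, List.length_cons, ← List.reverse_inj (xs := p), ← p.length_reverse]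
  generalize p.reverse = q
  match q with
  | [] => simp
  | [_] => simp
  | [_, _] => simp
  | [x, y, z] => simp [startsOneTwo_iff]; grind
  | x :: y :: z :: u :: v => simp [startsOneTwo_iff]

theorem count_eq_dropLast_add (t : List ℕ) (i : ℕ) :
    t.count i = t.dropLast.count i + if t.getLast? = some i then 1 else 0 := by
  rcases t.eq_nil_or_concat with rfl | ⟨u, x, rfl⟩
  · simp
  · simp [List.count_append, List.count_singleton]

/-- For a pattern with a single run, `t` is empty and the second summand vanishes, so the run is
counted once. -/
theorem numBoundaryRunsOfSize_eq {p : BinaryWord} {s : ℕ} {t : List ℕ} (h : runSizes p = s :: t)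
    (i : ℕ) : p.numBoundaryRunsOfSize i =
      (if s = i then 1 else 0) + if t.getLast? = some i then 1 else 0 := by
  unfold numBoundaryRunsOfSize numRuns
  rw [h, List.length_cons, Finset.range_eq_Ico, Finset.card_filter,
    Finset.sum_eq_sum_Ico_succ_bot (by omega)]
  congr 1
  · simp
  · rcases t.eq_nil_or_concat with rfl | ⟨u, x, rfl⟩
    · simp
    · rw [Finset.sum_eq_single (u.length + 1)]
      · simp
      · intro j hj hne
        simp at hj ⊢
        omega
      · simp

/-! ### The weight of the runs after the first -/

/-- The contribution of runs with sizes `t` to the ratio of the series for four occurrences and for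
one, where the first run of the pattern is not among them and the last one is. A run of size `3`
carries the factor `1 - X` unless it is last, because an inner run loses one of its two places for
further letters when it grows to size `4`. -/
noncomputable def runWeight (t : List ℕ) : ℤ⟦X⟧ :=
  X ^ 3 * (t.count 1 : ℤ⟦X⟧) + X ^ 2 * ((t.count 1).choose 2 : ℤ⟦X⟧) +
    X * (1 - X) * (t.dropLast.count 3 : ℤ⟦X⟧) + X * if t.getLast? = some 3 then 1 else 0

@[simp] theorem runWeight_nil : runWeight [] = 0 := by simp [runWeight]

theorem runWeight_one_cons (t : List ℕ) :
    runWeight (1 :: t) = runWeight t + X ^ 2 * (t.count 1 : ℤ⟦X⟧) + X ^ 3 := by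
  cases t with
  | nil => simp [runWeight]
  | cons s t =>
    simp only [runWeight, List.count_cons_self, List.dropLast_cons_cons, List.getLast?_cons_cons,
      Nat.choose_succ_succ' _ 1, Nat.choose_one_right]
    rw [List.count_cons_of_ne (by norm_num : 1 ≠ 3)]
    push_cast
    ring

theorem runWeight_three_singleton : runWeight [3] = X := by simp [runWeight]

theorem runWeight_three_cons_cons (s : ℕ) (t : List ℕ) :
    runWeight (3 :: s :: t) = runWeight (s :: t) + X * (1 - X) := by
  simp only [runWeight, List.dropLast_cons_cons, List.getLast?_cons_cons, List.count_cons_self]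
  rw [List.count_cons_of_ne (by norm_num : 3 ≠ 1)]
  push_cast
  ring

theorem runWeight_cons_of_ne {s : ℕ} (h1 : s ≠ 1) (h3 : s ≠ 3) (t : List ℕ) :
    runWeight (s :: t) = runWeight t := by
  cases t with
  | nil => simp [runWeight, h1, h3]
  | cons s' t =>
    simp only [runWeight, List.dropLast_cons_cons, List.getLast?_cons_cons,
      List.count_cons_of_ne h1, List.count_cons_of_ne h3]

/-! ### Closed forms for the joint counts -/

/-- The exponent `d` is `l - r`, the number of places between equal adjacent letters of `a :: q`. -/
theorem jointGF_zero_one (a : Bool) (q : BinaryWord) {d : ℕ}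
    (hd : d + numRuns (a :: q) = q.length + 1) :
    jointGF a q 0 1 = X ^ q.length * geom ^ (d + 1) := by
  induction q generalizing a d with
  | nil =>
    have : d = 0 := by simpa [numRuns] using hd
    simp [this, jointGF_singleton_one]
  | cons b q ih =>
    unfold numRuns at ih hd
    rcases Bool.eq_or_eq_not b a with rfl | rfl
    · rw [runSizes_cons_self, List.length_modifyHead] at hd
      have hle := numRuns_le_length (b :: q)
      unfold numRuns at hle
      obtain ⟨e, rfl⟩ : ∃ e, d = e + 1 := ⟨d - 1, by simp at hd hle; omega⟩
      rw [jointGF_cons_self b q one_ne_zero, ih b (d := e) (by simp at hd; omega)]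
      simp only [List.length_cons]
      ring
    · rw [runSizes_cons_not] at hd
      rw [jointGF_one_cons_not, ih (!a) (d := d) (by simp at hd; omega)]
      simp only [List.length_cons]
      ring

theorem jointGF_zero_two (a : Bool) (q : BinaryWord) {s : ℕ} {t : List ℕ}
    (h : runSizes (a :: q) = s :: t) :
    jointGF a q 0 2 = jointGF a q 0 1 * (X * (t.count 1 : ℤ⟦X⟧)) := by
  induction q generalizing a s t with
  | nil =>
    obtain ⟨-, rfl⟩ : 1 = s ∧ [] = t := by simpa using h
    rw [jointGF_singleton_of_ne_one a 0 (by norm_num)]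
    simp
  | cons b q ih =>
    obtain ⟨s', t', h'⟩ := exists_runSizes_cons b q
    rcases Bool.eq_or_eq_not b a with rfl | rfl
    · rw [runSizes_cons_self, h'] at h
      obtain ⟨-, rfl⟩ : _ ∧ t' = t := by simpa using h
      rw [jointGF_cons_self b q two_ne_zero, jointGF_cons_self b q one_ne_zero, ih b h']
      ring
    · rw [runSizes_cons_not, h'] at h
      obtain ⟨-, rfl⟩ : 1 = s ∧ (s' + 1) :: t' = t := by simpa using h
      rw [jointGF_one_cons_not]
      by_cases hq : q.head? = some (!a)
      · obtain ⟨q, rfl⟩ : ∃ q', q = (!a) :: q' := by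
          cases q with
          | nil => simp at hq
          | cons c q => exact ⟨q, by simpa using hq⟩
        obtain ⟨s'', t'', h''⟩ := exists_runSizes_cons (!a) q
        obtain ⟨rfl, -⟩ : s'' + 1 = s' ∧ t'' = t' := by
          simpa [runSizes_cons_self, h''] using h'
        rw [jointGF_two_cons_not_not, ih (!a) h', List.count_cons_of_ne (by omega)]
        ring
      · have hs : s' = 0 := by
          cases q with
          | nil => exact (by simpa using h' : s' = 0 ∧ t' = []).1
          | cons c q =>
            obtain rfl : c = a := by simpa using hq
            have := runSizes_cons_not (!c) q
            rw [Bool.not_not, h'] at this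
            simpa using (List.cons.inj this).1
        rw [jointGF_two_cons_not_of_single hq, ih (!a) h', hs, List.count_cons_self]
        push_cast
        ring

/-- The solution of the recursions for `jointGF a q 0 4`: the runs of `a :: q` after the first
enter through `runWeight`, a final pair of runs of sizes `2` and `1` through `EndsTwoOne`. -/
theorem jointGF_zero_four (a : Bool) (q : BinaryWord) {s : ℕ} {t : List ℕ}
    (h : runSizes (a :: q) = s :: t) :
    jointGF a q 0 4 = jointGF a q 0 1 *
      (runWeight t + X ^ 2 * (1 - X) * if EndsTwoOne (a :: q) then 1 else 0) := by
  induction q generalizing a s t with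
  | nil =>
    obtain ⟨-, rfl⟩ : 1 = s ∧ [] = t := by simpa using h
    rw [jointGF_singleton_of_ne_one a 0 (by norm_num)]
    simp [EndsTwoOne]
  | cons b q ih =>
    rcases Bool.eq_or_eq_not b a with rfl | rfl
    · obtain ⟨s', t', h'⟩ := exists_runSizes_cons b q
      rw [runSizes_cons_self, h'] at h
      obtain ⟨-, rfl⟩ : _ ∧ t' = t := by simpa using h
      have hE : EndsTwoOne (b :: b :: q) ↔ EndsTwoOne (b :: q) := by
        rw [endsTwoOne_cons_iff]; simp
      rw [jointGF_cons_self b q four_ne_zero, jointGF_cons_self b q one_ne_zero, ih b h']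
      simp only [hE]
      ring
    · rw [runSizes_cons_not] at h
      obtain ⟨-, rfl⟩ : 1 = s ∧ runSizes ((!a) :: q) = t := by simpa using h
      rw [jointGF_one_cons_not]
      have hnn : ∀ p, runSizes ((!a) :: a :: p) = 1 :: runSizes (a :: p) := fun p => by
        simpa using runSizes_cons_not (!a) p
      -- The second run of the pattern has size `1`, `2`, `3` or at least `4`; only in the last
      -- case, and for most runs of size `2`, is there no correction.
      match q, ih with
      | [], ih =>
        have hE : ¬ EndsTwoOne [a, !a] := by simp [EndsTwoOne]
        rw [jointGF_four_cons_not_of_single (by simp),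
          jointGF_singleton_of_ne_one _ 0 (by norm_num),
          jointGF_singleton_of_ne_one _ 0 (by norm_num), if_neg hE]
        simp [runWeight_one_cons]
        ring
      | c :: q, ih =>
        rcases Bool.eq_or_eq_not c a with rfl | rfl
        · have hE : EndsTwoOne (c :: (!c) :: c :: q) ↔ EndsTwoOne ((!c) :: c :: q) := by
            rw [endsTwoOne_cons_iff]; simp
          rw [jointGF_four_cons_not_of_single (by simp), ih (!c) (hnn q),
            jointGF_zero_two (!c) _ (hnn q), hnn q, runWeight_one_cons]
          simp only [hE]
          ring
        · rw [jointGF_four_cons_not_not]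
          obtain ⟨s', t', h'⟩ := exists_runSizes_cons (!a) q
          have h2 : runSizes ((!a) :: (!a) :: q) = (s' + 2) :: t' := by
            rw [runSizes_cons_self, h']; rfl
          rw [ih (!a) h2, h2]
          match q with
          | [] =>
            obtain ⟨rfl, rfl⟩ : s' = 0 ∧ t' = [] := by simpa using h'
            rw [doubleGF_nil, runWeight_cons_of_ne (by norm_num) (by norm_num)]
            simp [EndsTwoOne]
          | d :: q =>
            rcases Bool.eq_or_eq_not d a with rfl | rfl
            · obtain ⟨rfl, rfl⟩ : s' = 0 ∧ runSizes (d :: q) = t' := by simpa [hnn] using h'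
              rw [runWeight_cons_of_ne (by norm_num) (by norm_num)]
              match q with
              | [] =>
                have hE : EndsTwoOne [d, !d, !d, d] := by
                  rw [endsTwoOne_cons_iff]; simp
                have hE' : ¬ EndsTwoOne [!d, !d, d] := by simp [EndsTwoOne]
                have hD := doubleGF_not (!d)
                rw [Bool.not_not] at hD
                rw [if_pos hE, if_neg hE', hD, jointGF_cons_self _ _ one_ne_zero]
                linear_combination -X ^ 4 * jointGF (!d) [d] 0 1 * geom_mul_one_sub_X
              | c :: q =>
                have hE : EndsTwoOne (d :: (!d) :: (!d) :: d :: c :: q) ↔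
                    EndsTwoOne ((!d) :: (!d) :: d :: c :: q) := by
                  rw [endsTwoOne_cons_iff]; simp
                have hD := doubleGF_cons_not_cons (!d) c q
                rw [Bool.not_not] at hD
                rw [hD]
                simp only [hE]
                ring
            · have hE : EndsTwoOne (a :: (!a) :: (!a) :: (!a) :: q) ↔
                  EndsTwoOne ((!a) :: (!a) :: (!a) :: q) := by
                rw [endsTwoOne_cons_iff]; simp
              simp only [hE]
              match q with
              | [] =>
                obtain ⟨rfl, rfl⟩ : s' = 1 ∧ t' = [] := by
                  simpa [runSizes_cons_self] using h'
                rw [doubleGF_triple, jointGF_cons_self _ _ one_ne_zero,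
                  jointGF_cons_self _ _ one_ne_zero, runWeight_three_singleton, runWeight_nil]
                ring
              | c :: q =>
                rcases Bool.eq_or_eq_not c a with rfl | rfl
                · obtain ⟨s'', t'', h''⟩ := exists_runSizes_cons c q
                  obtain ⟨rfl, rfl⟩ : s' = 1 ∧ runSizes (c :: q) = t' := by
                    simpa [runSizes_cons_self, hnn] using h'
                  have hD := doubleGF_triple_not (!c) q
                  rw [Bool.not_not] at hD
                  rw [hD, jointGF_cons_self _ _ one_ne_zero, jointGF_cons_self _ _ one_ne_zero,
                    h'', runWeight_three_cons_cons]
                  linear_combination -X ^ 4 * geom * jointGF (!c) (c :: q) 0 1 *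
                    geom_mul_one_sub_X
                · obtain ⟨s'', t'', h''⟩ := exists_runSizes_cons (!a) q
                  obtain ⟨rfl, rfl⟩ : s'' + 1 + 1 = s' ∧ t'' = t' := by
                    simpa [runSizes_cons_self, h''] using h'
                  rw [doubleGF_quadruple, runWeight_cons_of_ne (by omega) (by omega)]
                  ring

/-! ### Patterns of length at least four -/

/-- The factor that turns the series for one occurrence of `p` into the series for four. -/
noncomputable def patternWeight (p : BinaryWord) : ℤ⟦X⟧ :=
  X ^ 3 * (p.numRunsOfSize 1 : ℤ⟦X⟧) + X ^ 2 * ((p.numRunsOfSize 1).choose 2 : ℤ⟦X⟧) +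
    X * (1 - X) * ((p.numRunsOfSize 3 : ℤ⟦X⟧) - (p.numBoundaryRunsOfSize 3 : ℤ⟦X⟧)) +
    X * (p.numBoundaryRunsOfSize 3 : ℤ⟦X⟧) + X ^ 2 * (1 - X) * (p.oneTwoBoundary : ℤ⟦X⟧)

/-- The weight of a pattern, with the contributions of its first run split off. -/
theorem patternWeight_eq {p : BinaryWord} {s : ℕ} {t : List ℕ} (h : runSizes p = s :: t)
    (hp : 4 ≤ p.length) :
    patternWeight p = runWeight t + (if s = 1 then X ^ 3 + X ^ 2 * (t.count 1 : ℤ⟦X⟧) else 0) +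
      (if s = 3 then X else 0) + X ^ 2 * (1 - X) * (if StartsOneTwo p then 1 else 0) +
      X ^ 2 * (1 - X) * (if EndsTwoOne p then 1 else 0) := by
  have hE : StartsOneTwo p.reverse ↔ EndsTwoOne p := by simp [EndsTwoOne, hp]
  unfold patternWeight numRunsOfSize oneTwoBoundary
  rw [numBoundaryRunsOfSize_eq h, h, List.count_cons, List.count_cons,
    count_eq_dropLast_add t 3, runWeight]
  simp only [hE, beq_iff_eq]
  by_cases h1 : s = 1
  · subst h1
    rw [if_pos rfl, if_pos rfl, Nat.choose_succ_succ' _ 1, Nat.choose_one_right,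
      if_neg (show (1 : ℕ) ≠ 3 by norm_num), if_neg (show (1 : ℕ) ≠ 3 by norm_num)]
    push_cast
    ring
  · rw [if_neg h1, if_neg h1, add_zero]
    split_ifs <;> push_cast <;> ring

theorem gf_occ_eq_four_of_length (a : Bool) (q : BinaryWord) (hq : 4 ≤ (a :: q).length) :
    (gf fun w => occ (a :: q) w = 4) =
      X * geom * (jointGF a q 0 1 * patternWeight (a :: q)) := by
  match q, hq with
  | b :: c :: d :: q, hq =>
    rcases Bool.eq_or_eq_not b a with rfl | rfl
    · -- The first run has size at least two.
      have hS : ¬ StartsOneTwo (b :: b :: c :: d :: q) := by simp [startsOneTwo_iff]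
      obtain ⟨s, t, h⟩ := exists_runSizes_cons b (c :: d :: q)
      have h' : runSizes (b :: b :: c :: d :: q) = (s + 2) :: t := by
        rw [runSizes_cons_self, h]; rfl
      rw [gf_occ_cons_self_eq_four, jointGF_zero_four _ _ h', patternWeight_eq h' hq, if_neg hS,
        if_neg (show s + 2 ≠ 1 by omega)]
      rcases Bool.eq_or_eq_not c b with rfl | rfl
      · rcases Bool.eq_or_eq_not d c with rfl | rfl
        · obtain ⟨s', t', h''⟩ := exists_runSizes_cons d q
          have : s = s' + 2 := by
            rw [runSizes_cons_self, runSizes_cons_self, h''] at h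
            simpa using (List.cons.inj h).1.symm
          rw [doubleGF_quadruple, if_neg (show s + 2 ≠ 3 by omega)]
          ring
        · have : s = 1 := by
            rw [runSizes_cons_self, runSizes_cons_not] at h
            simpa using (List.cons.inj h).1.symm
          rw [doubleGF_triple_not, if_pos (show s + 2 = 3 by omega),
            jointGF_cons_self _ _ one_ne_zero, jointGF_cons_self _ _ one_ne_zero]
          ring
      · have : s = 0 := by
          rw [runSizes_cons_not] at h
          simpa using (List.cons.inj h).1.symm
        rw [doubleGF_cons_not_cons, if_neg (show s + 2 ≠ 3 by omega)]
        ring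
    · -- The first run has size one.
      have h := runSizes_cons_not a (c :: d :: q)
      have hS := startsOneTwo_iff a (!a) c d q
      rw [patternWeight_eq h hq, if_pos rfl, if_neg (by norm_num)]
      rcases Bool.eq_or_eq_not c a with rfl | rfl
      · have hS' : ¬ StartsOneTwo (c :: (!c) :: c :: d :: q) := by simp [hS]
        rw [gf_occ_alternating_eq_four, jointGF_zero_four _ _ h, jointGF_zero_two _ _ h,
          if_neg hS']
        ring
      · rw [gf_occ_cons_not_not_eq_four, jointGF_zero_four _ _ h, jointGF_zero_two _ _ h]
        rcases Bool.eq_or_eq_not d a with rfl | rfl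
        · have hS' : StartsOneTwo (d :: (!d) :: (!d) :: d :: q) := by simp [hS]
          have hG := gf_cons_cons_zero_one_one_cons_not (!d) q
          rw [Bool.not_not] at hG
          rw [hG, if_pos hS', jointGF_one_cons_not, jointGF_cons_self _ _ one_ne_zero]
          linear_combination -X ^ 5 * geom * jointGF (!d) (d :: q) 0 1 * geom_mul_one_sub_X
        · have hS' : ¬ StartsOneTwo (a :: (!a) :: (!a) :: (!a) :: q) := by simp [hS]
          rw [gf_eq_zero fun w h => not_occ_pos_one (!a) q w ⟨by omega, h.2.2⟩, if_neg hS']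
          ring

/-! ### Coefficients -/

/-- The formula for long patterns, with `d = l - r` as a natural number. -/
theorem B_four_of_length {n : ℕ} {p : BinaryWord} (hp : 4 ≤ p.length) {d : ℕ}
    (hd : d + p.numRuns = p.length) :
    (B n p 4 : ℤ) =
      (p.numRunsOfSize 1 : ℤ) * binom ((n : ℤ) - (p.length + 3 : ℕ) + (d + 1 : ℕ)) (d + 1 : ℕ)
      + ((p.numRunsOfSize 1).choose 2 : ℤ)
          * binom ((n : ℤ) - (p.length + 2 : ℕ) + (d + 1 : ℕ)) (d + 1 : ℕ)
      + ((p.numRunsOfSize 3 : ℤ) - (p.numBoundaryRunsOfSize 3 : ℤ))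
          * binom ((n : ℤ) - (p.length + 1 : ℕ) + d) d
      + (p.numBoundaryRunsOfSize 3 : ℤ)
          * binom ((n : ℤ) - (p.length + 1 : ℕ) + (d + 1 : ℕ)) (d + 1 : ℕ)
      + (p.oneTwoBoundary : ℤ) * binom ((n : ℤ) - (p.length + 2 : ℕ) + d) d := by
  match p, hp with
  | a :: q, hp =>
    have key : (gf fun w => occ (a :: q) w = 4) =
        C (numRunsOfSize (a :: q) 1 : ℤ) * (X ^ ((a :: q).length + 3) * geom ^ (d + 1 + 1))
        + C ((numRunsOfSize (a :: q) 1).choose 2 : ℤ) *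
            (X ^ ((a :: q).length + 2) * geom ^ (d + 1 + 1))
        + C ((numRunsOfSize (a :: q) 3 : ℤ) - (numBoundaryRunsOfSize (a :: q) 3 : ℤ)) *
            (X ^ ((a :: q).length + 1) * geom ^ (d + 1))
        + C (numBoundaryRunsOfSize (a :: q) 3 : ℤ) *
            (X ^ ((a :: q).length + 1) * geom ^ (d + 1 + 1))
        + C (oneTwoBoundary (a :: q) : ℤ) * (X ^ ((a :: q).length + 2) * geom ^ (d + 1)) := by
      rw [gf_occ_eq_four_of_length a q hp, jointGF_zero_one a q (by simpa using hd),
        patternWeight, List.length_cons]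
      simp only [map_sub, map_natCast]
      linear_combination X ^ (q.length + 2) * geom ^ (d + 1) *
        ((numRunsOfSize (a :: q) 3 : ℤ⟦X⟧) - (numBoundaryRunsOfSize (a :: q) 3 : ℤ⟦X⟧) +
          X * (oneTwoBoundary (a :: q) : ℤ⟦X⟧)) * geom_mul_one_sub_X
    rw [B_eq_coeff_gf, key]
    simp only [map_add, coeff_C_mul, coeff_X_pow_mul_geom_pow]

theorem binom_natCast (a b : ℕ) : binom a b = a.choose b := by simp [binom]

theorem choose_two_add_choose_two (m : ℕ) :
    ((m + 2).choose 2 : ℤ) + (m + 1).choose 2 = ((m : ℤ) + 1) ^ 2 := by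
  induction m with
  | zero => rfl
  | succ m ih =>
    have h1 : (m + 1 + 2).choose 2 = (m + 2) + (m + 2).choose 2 := by
      rw [Nat.choose_succ_succ' _ 1, Nat.choose_one_right]
    have h2 : ((m + 2).choose 2 : ℤ) = (m + 1) + (m + 1).choose 2 := by
      rw [Nat.choose_succ_succ' _ 1, Nat.choose_one_right]
      push_cast
      ring
    rw [h1]
    push_cast
    linear_combination ih + h2

theorem coeff_square {n : ℕ} (hn : 5 ≤ n) :
    coeff n (X ^ 5 * geom ^ 3 + X ^ 6 * geom ^ 3) = ((n : ℤ) - 4) ^ 2 := by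
  obtain ⟨m, rfl⟩ := Nat.exists_eq_add_of_le' hn
  rw [map_add, coeff_X_pow_mul_geom_pow, coeff_X_pow_mul_geom_pow,
    show (((m + 5 : ℕ) : ℤ) - (5 : ℕ) + (2 : ℕ)) = ((m + 2 : ℕ) : ℤ) by push_cast; ring,
    show (((m + 5 : ℕ) : ℤ) - (6 : ℕ) + (2 : ℕ)) = ((m + 1 : ℕ) : ℤ) by push_cast; ring,
    binom_natCast, binom_natCast, choose_two_add_choose_two]
  push_cast
  ring

theorem coeff_linear {n a : ℕ} (hn : a ≤ n + 1) :
    coeff n (X ^ a * geom ^ 2) = (n : ℤ) - a + 1 := by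
  obtain ⟨m, hm⟩ := Nat.exists_eq_add_of_le hn
  rw [coeff_X_pow_mul_geom_pow, show ((n : ℤ) - a + (1 : ℕ)) = (m : ℤ) by push_cast; omega,
    binom_natCast, Nat.choose_one_right]
  omega

end BinaryWord

open PowerSeries BinaryWord in
theorem mainTheorem2 (n : ℕ) (hn : 5 ≤ n) (p : BinaryWord) (l r : ℕ)
    (hl : p.length = l) (hr : p.numRuns = r) :
    (4 ≤ l →
      (BinaryWord.B n p 4 : ℤ) =
        (p.numRunsOfSize 1 : ℤ) * BinaryWord.binom ((n : ℤ) - r - 2) ((l : ℤ) - r + 1)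
        + ((p.numRunsOfSize 1).choose 2 : ℤ)
            * BinaryWord.binom ((n : ℤ) - r - 1) ((l : ℤ) - r + 1)
        + ((p.numRunsOfSize 3 : ℤ) - (p.numBoundaryRunsOfSize 3 : ℤ))
            * BinaryWord.binom ((n : ℤ) - r - 1) ((l : ℤ) - r)
        + (p.numBoundaryRunsOfSize 3 : ℤ) * BinaryWord.binom ((n : ℤ) - r) ((l : ℤ) - r + 1)
        + (p.oneTwoBoundary : ℤ) * BinaryWord.binom ((n : ℤ) - r - 2) ((l : ℤ) - r)) ∧
    (l = 2 ∧ r = 1 → BinaryWord.B n p 4 = 0) ∧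
    ((l = 1 ∨ l = 3) ∧ r = 1 → BinaryWord.B n p 4 = n.choose 4) ∧
    (l = 3 ∧ r = 2 → (BinaryWord.B n p 4 : ℤ) = ((n : ℤ) - 4) ^ 2) ∧
    (l = 2 ∧ r = 2 → (BinaryWord.B n p 4 : ℤ) = 5 * (n : ℤ) - 19) ∧
    (l = 3 ∧ r = 3 → (BinaryWord.B n p 4 : ℤ) = 7 * (n : ℤ) - 31) := by
  have hpair : ∀ a, numRuns [a, a] = 1 ∧ numRuns [a, !a] = 2 := by decide
  have htriple : ∀ a, numRuns [a, a, a] = 1 ∧ numRuns [a, a, !a] = 2 ∧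
      numRuns [a, !a, !a] = 2 ∧ numRuns [a, !a, a] = 3 := by decide
  have hchoose : coeff n (X ^ 4 * geom ^ 5) = (n.choose 4 : ℤ) := by
    rw [coeff_X_pow_mul_geom_pow, sub_add_cancel, binom_natCast]
  subst hl hr
  refine ⟨fun hp => ?_, ?_, ?_, ?_, ?_, ?_⟩
  · obtain ⟨d, hd⟩ := Nat.exists_eq_add_of_le' (numRuns_le_length p)
    rw [B_four_of_length hp hd.symm, hd]
    push_cast
    ring_nf
  · rintro ⟨hl, hr⟩
    obtain ⟨a, b, rfl⟩ := List.length_eq_two.1 hl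
    rcases Bool.eq_or_eq_not b a with rfl | rfl
    · have h := B_eq_coeff_gf n [b, b] 4
      rw [gf_occ_pair_self, map_zero] at h
      exact_mod_cast h
    · simp [hpair] at hr
  · rintro ⟨hl | hl, hr⟩
    · obtain ⟨a, rfl⟩ := List.length_eq_one_iff.1 hl
      have h := B_eq_coeff_gf n [a] 4
      rw [gf_occ_singleton, hchoose] at h
      exact_mod_cast h
    · obtain ⟨a, b, c, rfl⟩ := List.length_eq_three.1 hl
      rcases Bool.eq_or_eq_not b a with rfl | rfl
      · rcases Bool.eq_or_eq_not c b with rfl | rfl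
        · have h := B_eq_coeff_gf n [c, c, c] 4
          rw [gf_occ_triple_self, hchoose] at h
          exact_mod_cast h
        · simp [htriple] at hr
      · rcases Bool.eq_or_eq_not c a with rfl | rfl <;> simp [htriple] at hr
  · rintro ⟨hl, hr⟩
    obtain ⟨a, b, c, rfl⟩ := List.length_eq_three.1 hl
    rcases Bool.eq_or_eq_not b a with rfl | rfl
    · rcases Bool.eq_or_eq_not c b with rfl | rfl
      · simp [htriple] at hr
      · rw [B_eq_coeff_gf, gf_occ_cons_self_not, coeff_square hn]
    · rcases Bool.eq_or_eq_not c a with rfl | rfl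
      · simp [htriple] at hr
      · rw [B_eq_coeff_gf, gf_occ_cons_not_not, coeff_square hn]
  · rintro ⟨hl, hr⟩
    obtain ⟨a, b, rfl⟩ := List.length_eq_two.1 hl
    rcases Bool.eq_or_eq_not b a with rfl | rfl
    · simp [hpair] at hr
    · rw [B_eq_coeff_gf, gf_occ_pair_not, map_add, show (4 : ℤ⟦X⟧) = C 4 from rfl, coeff_C_mul,
        coeff_linear (by omega), coeff_linear (by omega)]
      push_cast
      ring
  · rintro ⟨hl, hr⟩
    obtain ⟨a, b, c, rfl⟩ := List.length_eq_three.1 hl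
    rcases Bool.eq_or_eq_not b a with rfl | rfl
    · rcases Bool.eq_or_eq_not c b with rfl | rfl <;> simp [htriple] at hr
    · rcases Bool.eq_or_eq_not c a with rfl | rfl
      · rw [B_eq_coeff_gf, gf_occ_alternating, map_add, show (4 : ℤ⟦X⟧) = C 4 from rfl,
          show (3 : ℤ⟦X⟧) = C 3 from rfl, coeff_C_mul, coeff_C_mul,
          coeff_linear (by omega), coeff_linear (by omega)]
        push_cast
        ring
      · simp [htriple] at hr
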